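/- Let $\mathbb D$ be the open unit disc in $\mathbb C$, let $\mathbb G=\{(z_1+z_2,z_1z_2): z_1,z_2\in\mathbb D\}$ be the symmetrized bidisc, $\Delta=\{(2z,z^2): z\in\mathbb D\}$ and $D=\{(z,z): z\in\mathbb D\}$, and identify $\mathbb C^2$ with $\mathbb R^4$. For $\alpha\in\mathbb D$ put $\varphi_\alpha(z)=\dfrac{\alpha-z}{1-\overline\alpha z}$, and consider the (well-defined) map $q:\mathbb G\to[0,1)$ given by $q(z_1+z_2,z_1z_2)=|\varphi_{z_1}(z_2)|$ for $z_1,z_2\in\mathbb D$. For $a\in(0,1)$ let $\mathscr L_a=q^{-1}\{a\}\subset\mathbb G\setminus\Delta$ and $\mathscr F_a=\{(z_1,z_2)\in(\mathbb D\times\mathbb D)\setminus D: |\varphi_{z_1}(z_2)|=a\}$. Then: 1. $q|_{\mathbb G\setminus\Delta}:\mathbb G\setminus\Delta\to(0,1)$ is a $C^\infty$ submersion, and it is surjective. 2. There is a $C^\infty$ foliation of the real $4$-manifold $\mathbb G\setminus\Delta$, of dimension three and codimension one, whose leaves are exactly the sets $\mathscr L_a$, $a\in(0,1)$; each $\mathscr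 L_a$ is connected. 3. Each $\mathscr L_a$, $a\in(0,1)$, is an embedded $C^\infty$ submanifold of $\mathbb G\setminus\Delta$ of real dimension three. 4. For each $a\in(0,1)$, $\mathscr L_a=\mathscr F_a/\mathbb Z_2$, where $\mathbb Z_2=\{\pm1\}$ acts on $\mathscr F_a$ by $(-1)\cdot(z_1,z_2)=(z_2,z_1)$. That is, $\mathscr F_a$ is an embedded three-dimensional $C^\infty$ submanifold of $(\mathbb D\times\mathbb D)\setminus D$, the topological quotient $\mathscr F_a/\mathbb Z_2$ has a structure of $C^\infty$ $3$-manifold for which the quotient map is a local diffeomorphism, and $(z_1,z_2)\mapsto(z_1+z_2,z_1z_2)$ induces a diffeomorphism of $\mathscr F_a/\mathbb Z_2$ onto $\mathscr L_a$. -/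

import Mathlib

open scoped Manifold ContDiff ComplexConjugate Topology

noncomputable section

namespace SymBidisc

/-! ### Foliations of smooth manifolds -/

section Foliation

variable {E H : Type*} [NormedAddCommGroup E] [NormedSpace ℝ E] [TopologicalSpace H]

/-- A smooth foliation of dimension `k` and codimension `c` of a smooth manifold `M`, given by a
foliated atlas: smooth charts that cover `M`, map onto products `B₁ × B₂` of open
balls `B₁ ⊆ ℝᵏ`, `B₂ ⊆ ℝᶜ`, and whose changes of coordinates have the
form `(x, y) ↦ (h₁ (x, y), h₂ y)`. -/
structure Foliation (I : ModelWithCorners ℝ E H) (M : Type*) [TopologicalSpace M]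
    [ChartedSpace H M] (k c : ℕ) where
  /-- the distinguished charts -/
  charts : Set (OpenPartialHomeomorph M (EuclideanSpace ℝ (Fin k) × EuclideanSpace ℝ (Fin c)))
  smooth_chart : ∀ e ∈ charts,
    ContMDiffOn I 𝓘(ℝ, EuclideanSpace ℝ (Fin k) × EuclideanSpace ℝ (Fin c)) ∞ e e.source
  smooth_symm : ∀ e ∈ charts,
    ContMDiffOn 𝓘(ℝ, EuclideanSpace ℝ (Fin k) × EuclideanSpace ℝ (Fin c)) I ∞ e.symm e.target
  target_eq : ∀ e ∈ charts, ∃ (x₀ : EuclideanSpace ℝ (Fin k)) (y₀ : EuclideanSpace ℝ (Fin c))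
    (r s : ℝ), 0 < r ∧ 0 < s ∧ e.target = Metric.ball x₀ r ×ˢ Metric.ball y₀ s
  cover : ∀ x : M, ∃ e ∈ charts, x ∈ e.source
  compatible : ∀ e ∈ charts, ∀ e' ∈ charts, ∀ u ∈ (e.symm.trans e').source,
    ∀ v ∈ (e.symm.trans e').source, u.2 = v.2 → (e' (e.symm u)).2 = (e' (e.symm v)).2

namespace Foliation

variable {I : ModelWithCorners ℝ E H} {M : Type*} [TopologicalSpace M] [ChartedSpace H M]
  {k c : ℕ}

/-- Two points lie on a common plaque, that is, on one of the
slices `{x ∈ e.source | (e x).2 = y}` of a distinguished chart `e`. -/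
def SamePlaque (F : Foliation I M k c) (x y : M) : Prop :=
  ∃ e ∈ F.charts, x ∈ e.source ∧ y ∈ e.source ∧ (e x).2 = (e y).2

/-- The leaf through `x`: the points that can be reached from `x` by a finite chain of plaques. -/
def leaf (F : Foliation I M k c) (x : M) : Set M :=
  {y | Relation.ReflTransGen F.SamePlaque x y}

/-- The set of all leaves of a foliation. -/
def leaves (F : Foliation I M k c) : Set (Set M) := Set.range F.leaf

end Foliation

/-- The `k`-dimensional atlas `cs` makes the subset `S` of the smooth manifold `M` an embedded
smooth submanifold of `M`: `S`, with its subspace topology, becomes a smooth manifold and the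
inclusion a smooth embedding. (There is at most one such smooth structure on `S`.) -/
def IsSubmanifoldStructure (I : ModelWithCorners ℝ E H) {M : Type*} [TopologicalSpace M]
    [ChartedSpace H M] (k : ℕ) (S : Set M) (cs : ChartedSpace (EuclideanSpace ℝ (Fin k)) S) :
    Prop :=
  IsManifold (𝓡 k) ∞ S ∧ Manifold.IsSmoothEmbedding (𝓡 k) I ∞ (Subtype.val : S → M)

end Foliation

/-! ### The symmetrized bidisc -/

/-- The open unit disc `𝔻`. -/
def disc : Set ℂ := Metric.ball 0 1

/-- The Möbius map `φ_α (z) = (α - z) / (1 - ᾱ z)`. -/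
def moebius (α z : ℂ) : ℂ := (α - z) / (1 - conj α * z)

/-- The symmetrization map `(z₁, z₂) ↦ (z₁ + z₂, z₁ z₂)`. -/
def sym (z : ℂ × ℂ) : ℂ × ℂ := (z.1 + z.2, z.1 * z.2)

/-- The symmetrized bidisc `𝔾`. -/
def symBidisc : Set (ℂ × ℂ) := sym '' (disc ×ˢ disc)

/-- The royal variety `Δ`. -/
def royalVariety : Set (ℂ × ℂ) := {w | ∃ z ∈ disc, w = (2 * z, z ^ 2)}

/-- The diagonal `D` of the bidisc. -/
def diagonal : Set (ℂ × ℂ) := {w | ∃ z ∈ disc, w = (z, z)}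

theorem mem_disc {z : ℂ} : z ∈ disc ↔ ‖z‖ < 1 := by
  simp [disc]

theorem denom_ne_zero {α z : ℂ} (hα : α ∈ disc) (hz : z ∈ disc) : 1 - conj α * z ≠ 0 := by
  rw [mem_disc] at hα hz
  intro h
  have h1 : conj α * z = 1 := (sub_eq_zero.mp h).symm
  have h2 : ‖α‖ * ‖z‖ = 1 := by
    have := congrArg norm h1
    simpa using this
  nlinarith [norm_nonneg α, norm_nonneg z]

theorem norm_moebius_lt_one {α z : ℂ} (hα : α ∈ disc) (hz : z ∈ disc) : ‖moebius α z‖ < 1 := by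
  have hd : 0 < ‖1 - conj α * z‖ := norm_pos_iff.mpr (denom_ne_zero hα hz)
  rw [mem_disc] at hα hz
  rw [moebius, norm_div, div_lt_one hd]
  apply lt_of_pow_lt_pow_left₀ 2 (norm_nonneg _)
  have ha : ‖α‖ ^ 2 < 1 := by nlinarith [norm_nonneg α]
  have hb : ‖z‖ ^ 2 < 1 := by nlinarith [norm_nonneg z]
  rw [← Complex.normSq_eq_norm_sq, Complex.normSq_apply] at ha hb
  rw [← Complex.normSq_eq_norm_sq, ← Complex.normSq_eq_norm_sq, Complex.normSq_apply,
    Complex.normSq_apply]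
  simp only [Complex.sub_re, Complex.sub_im, Complex.mul_re, Complex.mul_im, Complex.conj_re,
    Complex.conj_im, Complex.one_re, Complex.one_im]
  nlinarith [mul_pos (sub_pos.mpr ha) (sub_pos.mpr hb)]

theorem norm_moebius_comm (z w : ℂ) : ‖moebius z w‖ = ‖moebius w z‖ := by
  have h : ‖1 - conj z * w‖ = ‖1 - conj w * z‖ := by
    rw [← RCLike.norm_conj (1 - conj z * w)]
    simp [mul_comm]
  rw [moebius, moebius, norm_div, norm_div, h, norm_sub_rev]

/-- The map `q : 𝔾 → [0, 1)`, `q (z₁ + z₂, z₁ z₂) = |φ_{z₁} (z₂)|`: the pair `(z₁, z₂)` of points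
of the disc is determined by the point of `𝔾` up to its order. -/
def q (w : symBidisc) : Set.Ico (0 : ℝ) 1 :=
  ⟨‖moebius w.2.choose.1 w.2.choose.2‖, norm_nonneg _,
    norm_moebius_lt_one w.2.choose_spec.1.1 w.2.choose_spec.1.2⟩

/-! ### The complements of the diagonal and of the royal variety as real 4-manifolds -/

theorem mem_symBidisc_iff (w : ℂ × ℂ) :
    w ∈ symBidisc ↔ ‖w.1 - conj w.1 * w.2‖ < 1 - ‖w.2‖ ^ 2 := by
  have key : ∀ z₁ z₂ : ℂ, (z₁ + z₂) - conj (z₁ + z₂) * (z₁ * z₂)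
      = z₁ * ((1 - ‖z₂‖ ^ 2 : ℝ) : ℂ) + z₂ * ((1 - ‖z₁‖ ^ 2 : ℝ) : ℂ) := by
    intro z₁ z₂
    have h1 := Complex.conj_mul' z₁
    have h2 := Complex.conj_mul' z₂
    push_cast
    rw [map_add, ← h1, ← h2]
    ring
  constructor
  · rintro ⟨⟨z₁, z₂⟩, ⟨h1, h2⟩, rfl⟩
    rw [mem_disc] at h1 h2
    simp only [sym] at *
    have n1 := norm_nonneg z₁
    have n2 := norm_nonneg z₂
    rw [key, norm_mul]
    have p1 : (0 : ℝ) ≤ 1 - ‖z₁‖ ^ 2 := by nlinarith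
    have p2 : (0 : ℝ) ≤ 1 - ‖z₂‖ ^ 2 := by nlinarith
    refine lt_of_le_of_lt (norm_add_le _ _) ?_
    rw [norm_mul, norm_mul, Complex.norm_real, Complex.norm_real, Real.norm_of_nonneg p1,
      Real.norm_of_nonneg p2]
    have hab : ‖z₁‖ * ‖z₂‖ < 1 := by nlinarith
    nlinarith [mul_pos (sub_pos.mpr hab) (mul_pos (sub_pos.mpr h1) (sub_pos.mpr h2))]
  · intro h
    obtain ⟨s, p⟩ := w
    simp only at h
    obtain ⟨d, hd⟩ := IsSquare.exists_sq (s ^ 2 - 4 * p)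
      (IsAlgClosed.exists_pow_nat_eq (s ^ 2 - 4 * p) (n := 2) (by norm_num) |>.elim
        fun x hx => ⟨x, by rw [← hx]; ring⟩)
    have main : ∀ z₁ z₂ : ℂ, s = z₁ + z₂ → p = z₁ * z₂ → ‖z₁‖ < 1 := by
      intro z₁ z₂ hs hp
      by_contra hc
      have hc : 1 ≤ ‖z₁‖ := not_lt.mp hc
      rw [hs, hp, key, norm_mul] at h
      have n1 := norm_nonneg z₁
      have n2 := norm_nonneg z₂
      have hpos : 0 < 1 - (‖z₁‖ * ‖z₂‖) ^ 2 := lt_of_le_of_lt (norm_nonneg _) h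
      have hab : ‖z₁‖ * ‖z₂‖ < 1 := by nlinarith [mul_nonneg n1 n2]
      have hb : ‖z₂‖ < 1 := by nlinarith
      have p1 : 1 - ‖z₁‖ ^ 2 ≤ 0 := by nlinarith
      have p2 : (0 : ℝ) ≤ 1 - ‖z₂‖ ^ 2 := by nlinarith
      have tri := norm_sub_le (z₁ * ((1 - ‖z₂‖ ^ 2 : ℝ) : ℂ) + z₂ * ((1 - ‖z₁‖ ^ 2 : ℝ) : ℂ))
        (z₂ * ((1 - ‖z₁‖ ^ 2 : ℝ) : ℂ))
      rw [add_sub_cancel_right, norm_mul, norm_mul, Complex.norm_real, Complex.norm_real,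
        Real.norm_of_nonneg p2, Real.norm_of_nonpos p1] at tri
      nlinarith [mul_nonneg (sub_nonneg.mpr hab.le)
        (mul_nonneg (sub_nonneg.mpr hc) (sub_nonneg.mpr hb.le))]
    have e1 : s = (s + d) / 2 + (s - d) / 2 := by ring
    have e2 : p = (s + d) / 2 * ((s - d) / 2) := by linear_combination (-1 / 4 : ℂ) * hd
    refine ⟨((s + d) / 2, (s - d) / 2), ⟨mem_disc.mpr (main _ _ e1 e2),
      mem_disc.mpr (main ((s - d) / 2) ((s + d) / 2) (by rw [add_comm]; exact e1)
        (by rw [mul_comm]; exact e2))⟩, ?_⟩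
    simp only [sym, Prod.mk.injEq]
    exact ⟨e1.symm, e2.symm⟩

theorem isOpen_symBidisc : IsOpen symBidisc := by
  have : symBidisc = {w : ℂ × ℂ | ‖w.1 - conj w.1 * w.2‖ < 1 - ‖w.2‖ ^ 2} := by
    ext w
    exact mem_symBidisc_iff w
  rw [this]
  refine isOpen_lt ?_ (by fun_prop)
  exact (continuous_fst.sub ((Complex.continuous_conj.comp continuous_fst).mul
    continuous_snd)).norm

/-- A point `(z₁ + z₂, z₁ z₂)` of `𝔾` lies on the royal variety exactly if `z₁ = z₂`. -/
theorem sym_mem_royalVariety_iff {z₁ z₂ : ℂ} (h1 : z₁ ∈ disc) :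
    sym (z₁, z₂) ∈ royalVariety ↔ z₁ = z₂ := by
  constructor
  · rintro ⟨z, -, hz⟩
    simp only [sym, Prod.mk.injEq] at hz
    obtain ⟨ha, hb⟩ := hz
    have : (z₁ - z₂) ^ 2 = 0 := by
      linear_combination (z₁ + z₂ + 2 * z) * ha - 4 * hb
    exact sub_eq_zero.mp (pow_eq_zero_iff (two_ne_zero) |>.mp this)
  · rintro rfl
    refine ⟨z₁, h1, ?_⟩
    simp only [sym, Prod.mk.injEq]
    constructor <;> ring

/-- The open subset `𝔾 ∖ Δ` of `ℂ²`. -/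
def symBidiscMinusRoyal : TopologicalSpace.Opens (ℂ × ℂ) where
  carrier := symBidisc \ royalVariety
  is_open' := by
    have : symBidisc \ royalVariety = symBidisc ∩ {w | w.1 ^ 2 ≠ 4 * w.2} := by
      ext w
      refine and_congr_right ?_
      rintro ⟨⟨z₁, z₂⟩, ⟨h1, h2⟩, rfl⟩
      rw [sym_mem_royalVariety_iff h1]
      simp only [sym, Set.mem_ofPred_eq, ne_eq, not_iff_not]
      constructor
      · rintro rfl
        ring
      · intro h
        have : (z₁ - z₂) ^ 2 = 0 := by linear_combination h
        exact sub_eq_zero.mp (pow_eq_zero_iff (two_ne_zero) |>.mp this)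
    rw [this]
    exact isOpen_symBidisc.inter (isOpen_ne_fun (by fun_prop) (by fun_prop))

/-- The open subset `𝔻 × 𝔻 ∖ D` of `ℂ²`. -/
def bidiscMinusDiagonal : TopologicalSpace.Opens (ℂ × ℂ) where
  carrier := (disc ×ˢ disc) \ diagonal
  is_open' := by
    have : (disc ×ˢ disc) \ diagonal = (disc ×ˢ disc) ∩ {w : ℂ × ℂ | w.1 ≠ w.2} := by
      ext ⟨z₁, z₂⟩
      refine and_congr_right ?_
      rintro ⟨h1, -⟩
      simp only [diagonal, Set.mem_ofPred_eq, Prod.mk.injEq, ne_eq, not_iff_not]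
      constructor
      · rintro ⟨z, -, rfl, rfl⟩
        rfl
      · rintro rfl
        exact ⟨z₁, h1, rfl, rfl⟩
    rw [this]
    exact (Metric.isOpen_ball.prod Metric.isOpen_ball).inter
      (isOpen_ne_fun continuous_fst continuous_snd)

/-- The open interval `(0, 1)`. -/
def openUnitInterval : TopologicalSpace.Opens ℝ := ⟨Set.Ioo 0 1, isOpen_Ioo⟩

/-- The restriction of `q` to a map `𝔾 ∖ Δ → (0, 1)`. -/
def qRestrict (w : symBidiscMinusRoyal) : openUnitInterval :=
  ⟨q ⟨w.1, w.2.1⟩, by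
    have hw : (w : ℂ × ℂ) ∈ symBidisc := w.2.1
    refine ⟨?_, (q ⟨w.1, w.2.1⟩).2.2⟩
    change 0 < ‖moebius hw.choose.1 hw.choose.2‖
    obtain ⟨⟨h1, h2⟩, h3⟩ := hw.choose_spec
    have hne : hw.choose.1 ≠ hw.choose.2 := by
      intro h
      apply w.2.2
      rw [← h3]
      exact (sym_mem_royalVariety_iff h1).mpr h
    exact norm_pos_iff.mpr (div_ne_zero (sub_ne_zero.mpr hne) (denom_ne_zero h1 h2))⟩

/-- The level set `𝓛_a = q⁻¹ {a}` in `𝔾 ∖ Δ`. -/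
def leafL (a : ℝ) : Set symBidiscMinusRoyal := {w | (qRestrict w : ℝ) = a}

/-- The level set `𝓕_a = f⁻¹ {a}` in `𝔻 × 𝔻 ∖ D` of `f (z₁, z₂) = |φ_{z₁} (z₂)|`. -/
def leafF (a : ℝ) : Set bidiscMinusDiagonal := {z | ‖moebius z.1.1 z.1.2‖ = a}

/-! ### The action of `ℤ₂ = {1, -1}` -/

/-- The coordinate swap `(z₁, z₂) ↦ (z₂, z₁)` on `𝓕_a`. -/
def swapF {a : ℝ} (z : leafF a) : leafF a :=
  ⟨⟨(z.1.1.2, z.1.1.1), ⟨z.1.2.1.2, z.1.2.1.1⟩, by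
    rintro ⟨t, ht, h⟩
    obtain ⟨ha, hb⟩ := Prod.mk.inj h
    exact z.1.2.2 ⟨t, ht, Prod.ext hb ha⟩⟩,
    (norm_moebius_comm _ _).trans z.2⟩

/-- The action of `ℤ₂ = {1, -1}` on `𝓕_a` in which `-1` swaps the coordinates. -/
instance (a : ℝ) : MulAction ℤˣ (leafF a) where
  smul u z := if u = 1 then z else swapF z
  one_smul z := if_pos rfl
  mul_smul u v z := by
    change (if u * v = 1 then z else swapF z)
      = if u = 1 then (if v = 1 then z else swapF z) else swapF (if v = 1 then z else swapF z)
    rcases Int.units_eq_one_or u with rfl | rfl <;> rcases Int.units_eq_one_or v with rfl | rfl <;>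
      simp [swapF]

/-- The quotient `𝓕_a / ℤ₂`, with the quotient topology. -/
abbrev quotientF (a : ℝ) : Type := MulAction.orbitRel.Quotient ℤˣ (leafF a)

/-- The quotient map `𝓕_a → 𝓕_a / ℤ₂`. -/
def quotientMap (a : ℝ) (z : leafF a) : quotientF a := Quotient.mk _ z

end SymBidisc

end

noncomputable section

namespace SymBidisc

open TopologicalSpace

/-! ### Smooth local coordinates on normed spaces -/

section SmoothCoordinates

variable {E F G : Type*} [NormedAddCommGroup E] [NormedSpace ℝ E] [NormedAddCommGroup F]
  [NormedSpace ℝ F] [NormedAddCommGroup G] [NormedSpace ℝ G]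

/-! In terms of `s = z₁ + z₂` and `p = z₁ z₂` one has `|z₁ - z₂|² = |s² - 4p|` and `|1 - z̄₁ z₂|² =
1 + |s² - 4p|/2 - |s|²/2 + |p|²`. Hence `q` is an explicit function `qFun` of `(s, p)`, smooth
wherever `s² ≠ 4p`, that is, off the royal variety (`contDiffOn_qFun`).

Since `φ_α` is an involution of the disc, `q (sym (z, φ_z (u))) = |u|`. Moving `u` radially gives a
curve along which `q` has derivative 1, so `q` is a submersion (`surjective_fderiv_qFun`). Letting
`u` run around the circle `|u| = a` and `z` over the disc exhibits `𝓛_a` as a continuous image of a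
connected set (`isConnected_leafL`).

The inverse function theorem then yields local coordinates whose last entry is `q`
(`exists_isSmoothCoord_qFun`). They serve at once as submersion charts, foliated charts and slice
charts of `𝓛_a`. Plaques lie in level sets, and a connected level set is a single leaf
(`leaf_qFoliation`).

Off the diagonal the Jacobian of `sym` is invertible and the fibres of `sym` are the orbits of the
swap. So `𝓕_a → 𝓛_a` is an open local diffeomorphism that descends to a homeomorphism from `𝓕_a /
ℤ₂`, along which the smooth structure of `𝓛_a` is pulled back. -/

/-- A partial homeomorphism between normed spaces that is smooth in both directions. -/
structure IsSmoothCoord (e : OpenPartialHomeomorph E F) : Prop where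
  contDiffOn : ContDiffOn ℝ ∞ e e.source
  contDiffOn_symm : ContDiffOn ℝ ∞ e.symm e.target

theorem IsSmoothCoord.trans {e : OpenPartialHomeomorph E F} {e' : OpenPartialHomeomorph F G}
    (he : IsSmoothCoord e) (he' : IsSmoothCoord e') : IsSmoothCoord (e.trans e') where
  contDiffOn := he'.contDiffOn.comp (he.contDiffOn.mono fun _ h => h.1) fun _ h => h.2
  contDiffOn_symm :=
    he.contDiffOn_symm.comp (he'.contDiffOn_symm.mono fun _ h => h.1) fun _ h => h.2

theorem ContinuousLinearEquiv.isSmoothCoord (A : E ≃L[ℝ] F) :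
    IsSmoothCoord A.toHomeomorph.toOpenPartialHomeomorph :=
  ⟨A.contDiff.contDiffOn, A.symm.contDiff.contDiffOn⟩

/-- The smooth inverse function theorem, with a local inverse that is smooth on its domain. -/
theorem exists_isSmoothCoord [CompleteSpace E] {U : Set E} (hU : IsOpen U) {g : E → F}
    (hg : ContDiffOn ℝ ∞ g U) {x : E} (hx : x ∈ U) {g' : E ≃L[ℝ] F}
    (hg' : HasFDerivAt g (g' : E →L[ℝ] F) x) :
    ∃ e : OpenPartialHomeomorph E F,
      x ∈ e.source ∧ e.source ⊆ U ∧ (e : E → F) = g ∧ IsSmoothCoord e := by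
  have hgx : ContDiffAt ℝ ∞ g x := hg.contDiffAt (hU.mem_nhds hx)
  -- `V` is the open set of points with invertible derivative. Restricting to it makes the local
  -- inverse smooth at every point of its domain, not only at `g x`.
  set V : Set E := U ∩ fderiv ℝ g ⁻¹' Set.range ((↑) : (E ≃L[ℝ] F) → E →L[ℝ] F)
  have hV : IsOpen V :=
    (hg.continuousOn_fderiv_of_isOpen hU (by simp)).isOpen_inter_preimage hU
      ContinuousLinearEquiv.isOpen
  set e₀ := hgx.toOpenPartialHomeomorph g hg' (by simp)
  have he₀ : (e₀ : E → F) = g := rfl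
  refine ⟨e₀.restrOpen V hV,
    ⟨hgx.mem_toOpenPartialHomeomorph_source hg' (by simp), hx, g', hg'.fderiv.symm⟩,
    fun y hy => hy.2.1, he₀, hg.mono fun y hy => hy.2.1, fun y hy => ?_⟩
  obtain ⟨-, hyU, A, hA⟩ := (e₀.restrOpen V hV).map_target hy
  have hgy : ContDiffAt ℝ ∞ g ((e₀.restrOpen V hV).symm y) := hg.contDiffAt (hU.mem_nhds hyU)
  refine ((e₀.restrOpen V hV).contDiffAt_symm hy (f₀' := A) ?_ hgy).contDiffWithinAt
  rw [hA]
  exact (hgy.differentiableAt (by simp)).hasFDerivAt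

/-- A function with surjective derivative is the last coordinate of a smooth coordinate system. -/
theorem exists_isSmoothCoord_snd [FiniteDimensional ℝ E] [FiniteDimensional ℝ F]
    [FiniteDimensional ℝ G] {U : Set E} (hU : IsOpen U) {g : E → G}
    (hg : ContDiffOn ℝ ∞ g U) {x : E} (hx : x ∈ U) (hsurj : Function.Surjective (fderiv ℝ g x))
    (hdim : Module.finrank ℝ E = Module.finrank ℝ F + Module.finrank ℝ G) :
    ∃ e : OpenPartialHomeomorph E (F × G),
      x ∈ e.source ∧ e.source ⊆ U ∧ (∀ y, (e y).2 = g y) ∧ IsSmoothCoord e := by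
  have : CompleteSpace E := FiniteDimensional.complete ℝ E
  set L := fderiv ℝ g x
  have hker : Module.finrank ℝ (L : E →ₗ[ℝ] G).ker = Module.finrank ℝ F := by
    have h1 := (L : E →ₗ[ℝ] G).finrank_range_add_finrank_ker
    rw [LinearMap.range_eq_top.mpr hsurj, finrank_top] at h1
    omega
  -- The projection `K` onto `ker L` along a complement has a kernel complementary to `ker L`, so
  -- `(K, L)` is an isomorphism; it is the derivative of `(K, g)` at `x`.
  obtain ⟨q, hq⟩ := (L : E →ₗ[ℝ] G).ker.exists_isCompl
  let B : (L : E →ₗ[ℝ] G).ker ≃ₗ[ℝ] F := LinearEquiv.ofFinrankEq _ _ hker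
  let K : E →ₗ[ℝ] F := B.toLinearMap ∘ₗ (L : E →ₗ[ℝ] G).ker.projectionOnto q hq
  have hKker : K.ker = q := by
    rw [LinearEquiv.ker_comp, Submodule.ker_projectionOnto]
  have hKrange : K.range = ⊤ := by
    rw [LinearMap.range_eq_top]
    exact B.surjective.comp (LinearMap.range_eq_top.mp (Submodule.range_projectionOnto hq))
  let A : E ≃L[ℝ] F × G := (ContinuousLinearMap.equivProdOfSurjectiveOfIsCompl
    (LinearMap.toContinuousLinearMap K) L hKrange (LinearMap.range_eq_top.mpr hsurj)
    (by rw [show (LinearMap.toContinuousLinearMap K).ker = K.ker from rfl, hKker]; exact hq.symm))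
  have hd : HasFDerivAt (fun y => (LinearMap.toContinuousLinearMap K y, g y))
      (A : E →L[ℝ] F × G) x :=
    (LinearMap.toContinuousLinearMap K).hasFDerivAt.prodMk
      ((hg.contDiffAt (hU.mem_nhds hx)).differentiableAt (by simp)).hasFDerivAt
  obtain ⟨e, hxe, heU, he, hs⟩ := exists_isSmoothCoord hU
    ((LinearMap.toContinuousLinearMap K).contDiff.contDiffOn.prodMk hg) hx hd
  exact ⟨e, hxe, heU, fun y => by rw [he], hs⟩

/-- The restriction of smooth coordinates to an open submanifold, in both directions. -/
theorem IsSmoothCoord.contMDiffOn_subtypeRestr {e : OpenPartialHomeomorph E F}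
    (he : IsSmoothCoord e) (U : Opens E) (hU : Nonempty U) :
    ContMDiffOn 𝓘(ℝ, E) 𝓘(ℝ, F) ∞ (e.subtypeRestr hU) (e.subtypeRestr hU).source := by
  rw [OpenPartialHomeomorph.subtypeRestr_coe, OpenPartialHomeomorph.subtypeRestr_source]
  exact he.contDiffOn.contMDiffOn.comp contMDiff_subtype_val.contMDiffOn fun _ h => h

theorem IsSmoothCoord.contMDiffOn_subtypeRestr_symm {e : OpenPartialHomeomorph E F}
    (he : IsSmoothCoord e) (U : Opens E) (hU : Nonempty U) :
    ContMDiffOn 𝓘(ℝ, F) 𝓘(ℝ, E) ∞ (e.subtypeRestr hU).symm (e.subtypeRestr hU).target := by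
  intro y hy
  rw [← ContMDiffWithinAt.subtypeVal_comp_iff]
  have h := (he.contDiffOn_symm.contMDiffOn y (e.subtypeRestr_target_subset hU hy)).mono
    (e.subtypeRestr_target_subset hU)
  exact h.congr (fun z hz => e.subtypeRestr_symm_apply hU hz) (e.subtypeRestr_symm_apply hU hy)

theorem IsSmoothCoord.subtypeRestr_mem_maximalAtlas {e : OpenPartialHomeomorph E E}
    (he : IsSmoothCoord e) (U : Opens E) (hU : Nonempty U) :
    e.subtypeRestr hU ∈ IsManifold.maximalAtlas 𝓘(ℝ, E) ∞ U :=
  OpenPartialHomeomorph.mem_maximalAtlas_of_contMDiffOn _ (he.contMDiffOn_subtypeRestr U hU)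
    (he.contMDiffOn_subtypeRestr_symm U hU)

end SmoothCoordinates

/-! ### Submanifolds given by slice charts -/

section Slice

universe u

variable {E : Type u} {V : Type*} {W : Type u} [NormedAddCommGroup E] [NormedSpace ℝ E]
  [NormedAddCommGroup V] [NormedSpace ℝ V] [NormedAddCommGroup W] [NormedSpace ℝ W]

variable (V W) in
/-- Smooth coordinates of the ambient space around a point `x` of the subset `S` of the open set
`U`, in which `S` is the slice on which the second coordinate has the value `c`. -/
structure SliceChart {U : Opens E} (S : Set U) (x : S) where
  /-- the coordinates -/
  coord : OpenPartialHomeomorph E (V × W)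
  /-- the value of the second coordinate -/
  c : W
  isSmoothCoord : IsSmoothCoord coord
  mem_source : (x : U).1 ∈ coord.source
  source_subset : coord.source ⊆ U
  mem_iff : ∀ y : U, y.1 ∈ coord.source → (y ∈ S ↔ (coord y.1).2 = c)

namespace SliceChart

variable {U : Opens E} {S : Set U} {x x' : S}

/-- The point of `S` with prescribed coordinates. -/
def invFun (e : SliceChart V W S x) (u : V) : S :=
  open Classical in
  -- The value `x` off the target is arbitrary; charts only use `u` in the target.
  if h : (u, e.c) ∈ e.coord.target then
    ⟨⟨e.coord.symm (u, e.c), e.source_subset (e.coord.map_target h)⟩,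
      (e.mem_iff _ (e.coord.map_target h)).2 (by rw [e.coord.right_inv h])⟩
  else x

theorem coe_invFun (e : SliceChart V W S x) {u : V} (h : (u, e.c) ∈ e.coord.target) :
    ((e.invFun u : U) : E) = e.coord.symm (u, e.c) := by
  rw [invFun, dif_pos h]

theorem coord_eq (e : SliceChart V W S x) {y : S} (hy : (y : U).1 ∈ e.coord.source) :
    ((e.coord (y : U).1).1, e.c) = e.coord (y : U).1 :=
  Prod.ext rfl ((e.mem_iff y hy).1 y.2).symm

/-- The chart of `S` given by the first coordinate. -/
def toChart (e : SliceChart V W S x) : OpenPartialHomeomorph S V where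
  toFun y := (e.coord (y : U).1).1
  invFun := e.invFun
  source := {y | (y : U).1 ∈ e.coord.source}
  target := {u | (u, e.c) ∈ e.coord.target}
  map_source' y hy := by
    change ((e.coord (y : U).1).1, e.c) ∈ e.coord.target
    rw [e.coord_eq hy]
    exact e.coord.map_source hy
  map_target' u hu := by
    change _ ∈ e.coord.source
    rw [e.coe_invFun hu]
    exact e.coord.map_target hu
  left_inv' y hy := by
    refine Subtype.ext (Subtype.ext ?_)
    have h := e.coord_eq hy
    rw [e.coe_invFun (h ▸ e.coord.map_source hy), h, e.coord.left_inv hy]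
  right_inv' u hu := by
    rw [e.coe_invFun hu, e.coord.right_inv hu]
  open_source := e.coord.open_source.preimage (by fun_prop)
  open_target := e.coord.open_target.preimage (by fun_prop)
  continuousOn_toFun := continuous_fst.comp_continuousOn
    (e.coord.continuousOn.comp (by fun_prop) fun _ h => h)
  continuousOn_invFun := by
    rw [Topology.IsInducing.subtypeVal.continuousOn_iff,
      Topology.IsInducing.subtypeVal.continuousOn_iff]
    have h : ContinuousOn (fun u => e.coord.symm (u, e.c)) {u | (u, e.c) ∈ e.coord.target} :=
      e.coord.continuousOn_symm.comp (by fun_prop) fun _ h => h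
    exact h.congr fun u hu => e.coe_invFun hu

/-- Changes of charts extend to the ambient space: insert the constant `e.c`, change ambient
coordinates, and project to the first factor. -/
theorem contDiffOn_transition (e : SliceChart V W S x) (e' : SliceChart V W S x') :
    ContDiffOn ℝ ∞ (e.toChart.symm.trans e'.toChart)
      (e.toChart.symm.trans e'.toChart).source := by
  have h : ContDiffOn ℝ ∞ (fun u => (e'.coord (e.coord.symm (u, e.c))).1)
      (e.toChart.symm.trans e'.toChart).source := by
    refine contDiff_fst.comp_contDiffOn (e'.isSmoothCoord.contDiffOn.comp
      (e.isSmoothCoord.contDiffOn_symm.comp (by fun_prop) fun u hu => hu.1) fun u hu => ?_)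
    have h2 : ((e.invFun u : U) : E) ∈ e'.coord.source := hu.2
    rwa [e.coe_invFun hu.1] at h2
  refine h.congr fun u hu => ?_
  change (e'.coord ((e.invFun u : U) : E)).1 = _
  rw [e.coe_invFun hu.1]

/-- The charted space structure on `S` given by slice charts around its points. -/
abbrev chartedSpace (Φ : ∀ x : S, SliceChart V W S x) : ChartedSpace V S where
  atlas := Set.range fun x => (Φ x).toChart
  chartAt x := (Φ x).toChart
  mem_chart_source x := (Φ x).mem_source
  chart_mem_atlas x := ⟨x, rfl⟩

theorem isManifold (Φ : ∀ x : S, SliceChart V W S x) :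
    letI := chartedSpace Φ
    IsManifold 𝓘(ℝ, V) ∞ S := by
  let := chartedSpace Φ
  refine isManifold_of_contDiffOn _ _ _ ?_
  rintro _ _ ⟨x, rfl⟩ ⟨x', rfl⟩
  simpa using contDiffOn_transition (Φ x) (Φ x')

theorem isSmoothEmbedding (A : (V × W) ≃L[ℝ] E) (Φ : ∀ x : S, SliceChart V W S x) :
    letI := chartedSpace Φ
    Manifold.IsSmoothEmbedding 𝓘(ℝ, V) 𝓘(ℝ, E) ∞ (Subtype.val : S → U) := by
  let := chartedSpace Φ
  have := isManifold Φ
  refine ⟨⟨W, inferInstance, inferInstance, fun x => ?_⟩, Topology.IsEmbedding.subtypeVal⟩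
  have hU : Nonempty U := ⟨x⟩
  -- The normal form of an immersion is `u ↦ A (u, 0)`, so the slice value `c` is translated to `0`
  -- before `A` carries the coordinates to `E`.
  let τ : OpenPartialHomeomorph (V × W) (V × W) :=
    (Homeomorph.addRight ((0, -(Φ x).c) : V × W)).toOpenPartialHomeomorph
  have hτ : IsSmoothCoord τ :=
    ⟨contDiffOn_id.add contDiffOn_const, contDiffOn_id.add contDiffOn_const⟩
  let e : OpenPartialHomeomorph E E :=
    ((Φ x).coord.trans τ).trans A.toHomeomorph.toOpenPartialHomeomorph
  have he : IsSmoothCoord e :=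
    ((Φ x).isSmoothCoord.trans hτ).trans (ContinuousLinearEquiv.isSmoothCoord A)
  have hes : e.source = (Φ x).coord.source := by
    ext y
    simp [e, τ]
  refine Manifold.IsImmersionAtOfComplement.mk_of_charts A (Φ x).toChart (e.subtypeRestr hU)
    (Φ x).mem_source ?_ (IsManifold.chart_mem_maximalAtlas (I := 𝓘(ℝ, V)) x)
    (he.subtypeRestr_mem_maximalAtlas U hU) ?_ ?_
  · rw [OpenPartialHomeomorph.subtypeRestr_source, Set.mem_preimage, hes]
    exact (Φ x).mem_source
  · intro y hy
    rw [OpenPartialHomeomorph.subtypeRestr_source, Set.mem_preimage, Set.mem_preimage, hes]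
    exact hy
  · intro u hu
    rw [OpenPartialHomeomorph.extend_target] at hu
    replace hu : (u, (Φ x).c) ∈ (Φ x).coord.target := hu.1
    change A ((Φ x).coord (((Φ x).invFun u : U) : E) + (0, -(Φ x).c)) = A (u, 0)
    rw [(Φ x).coe_invFun hu, (Φ x).coord.right_inv hu]
    simp

end SliceChart

/-- Slice charts around all points of `S` make it an embedded submanifold. -/
theorem isSubmanifoldStructure_chartedSpace {k : ℕ} {U : Opens E} {S : Set U}
    (A : (EuclideanSpace ℝ (Fin k) × W) ≃L[ℝ] E)
    (Φ : ∀ x : S, SliceChart (EuclideanSpace ℝ (Fin k)) W S x) :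
    IsSubmanifoldStructure 𝓘(ℝ, E) k S (SliceChart.chartedSpace Φ) :=
  ⟨SliceChart.isManifold Φ, SliceChart.isSmoothEmbedding A Φ⟩

end Slice

/-! ### Local diffeomorphisms that are the identity in charts -/

section LocalDiffeo

variable {H M N : Type*} [NormedAddCommGroup H] [NormedSpace ℝ H] [TopologicalSpace M]
  [TopologicalSpace N]

/-- A map that is the identity in suitable charts is a local diffeomorphism. -/
theorem isLocalDiffeomorphAt_of_charts [ChartedSpace H M] [ChartedSpace H N]
    [IsManifold 𝓘(ℝ, H) ∞ M] [IsManifold 𝓘(ℝ, H) ∞ N] {f : M → N} {x : M}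
    {e : OpenPartialHomeomorph M H} {e' : OpenPartialHomeomorph N H}
    (he : e ∈ IsManifold.maximalAtlas 𝓘(ℝ, H) ∞ M)
    (he' : e' ∈ IsManifold.maximalAtlas 𝓘(ℝ, H) ∞ N) (hx : x ∈ e.source)
    (hmaps : Set.MapsTo f e.source e'.source) (heq : ∀ y ∈ e.source, e y = e' (f y)) :
    IsLocalDiffeomorphAt 𝓘(ℝ, H) 𝓘(ℝ, H) ∞ f x := by
  -- By `heq`, `e'.symm ∘ e` agrees with `f` on `e.source`, and it is smooth in both directions.
  let φ := e.trans e'.symm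
  have hmem : ∀ y ∈ e.source, y ∈ φ.source := fun y hy => by
    refine ⟨hy, ?_⟩
    change e y ∈ e'.target
    rw [heq y hy]
    exact e'.map_source (hmaps hy)
  refine ⟨{ toPartialEquiv := φ.toPartialEquiv
            open_source := φ.open_source
            open_target := φ.open_target
            contMDiffOn_toFun := (contMDiffOn_symm_of_mem_maximalAtlas he').comp
              ((contMDiffOn_of_mem_maximalAtlas he).mono fun _ h => h.1) fun _ h => h.2
            contMDiffOn_invFun := (contMDiffOn_symm_of_mem_maximalAtlas he).comp
              ((contMDiffOn_of_mem_maximalAtlas he').mono fun _ h => h.1) fun _ h => h.2 },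
    hmem x hx, fun y hy => ?_⟩
  change f y = e'.symm (e y)
  rw [heq y hy.1, e'.left_inv (hmaps hy.1)]

/-- The charted space structure transported along a homeomorphism. -/
abbrev pullbackChartedSpace [ChartedSpace H N] (h : M ≃ₜ N) : ChartedSpace H M where
  atlas := (fun e => h.toOpenPartialHomeomorph.trans e) '' atlas H N
  chartAt x := h.toOpenPartialHomeomorph.trans (chartAt H (h x))
  mem_chart_source x := by simp
  chart_mem_atlas x := ⟨_, chart_mem_atlas H (h x), rfl⟩

/-- The homeomorphism cancels in every change of charts, leaving one of `N`. -/
theorem isManifold_pullbackChartedSpace [ChartedSpace H N] [IsManifold 𝓘(ℝ, H) ∞ N]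
    (h : M ≃ₜ N) :
    letI : ChartedSpace H M := pullbackChartedSpace h
    IsManifold 𝓘(ℝ, H) ∞ M := by
  let : ChartedSpace H M := pullbackChartedSpace h
  refine isManifold_of_contDiffOn _ _ _ ?_
  rintro _ _ ⟨e, he, rfl⟩ ⟨e', he', rfl⟩
  have h1 := contMDiffOn_of_mem_contDiffGroupoid
    (HasGroupoid.compatible (G := contDiffGroupoid ∞ 𝓘(ℝ, H)) he he')
  rw [contMDiffOn_iff_contDiffOn] at h1
  refine (h1.congr_mono ?_ ?_)
  · intro u _
    simp
  · intro u hu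
    simpa using hu

theorem trans_mem_maximalAtlas_pullback [ChartedSpace H N] [IsManifold 𝓘(ℝ, H) ∞ N]
    (h : M ≃ₜ N) {e : OpenPartialHomeomorph N H} (he : e ∈ atlas H N) :
    letI : ChartedSpace H M := pullbackChartedSpace h
    h.toOpenPartialHomeomorph.trans e ∈ IsManifold.maximalAtlas 𝓘(ℝ, H) ∞ M := by
  let : ChartedSpace H M := pullbackChartedSpace h
  have := isManifold_pullbackChartedSpace (H := H) h
  exact IsManifold.subset_maximalAtlas ⟨e, he, rfl⟩

theorem isLocalDiffeomorph_pullback [ChartedSpace H N] [IsManifold 𝓘(ℝ, H) ∞ N] (h : M ≃ₜ N) :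
    letI : ChartedSpace H M := pullbackChartedSpace h
    IsLocalDiffeomorph 𝓘(ℝ, H) 𝓘(ℝ, H) ∞ h := by
  let : ChartedSpace H M := pullbackChartedSpace h
  have := isManifold_pullbackChartedSpace (H := H) h
  intro x
  exact isLocalDiffeomorphAt_of_charts
    (trans_mem_maximalAtlas_pullback h (chart_mem_atlas H (h x)))
    (IsManifold.chart_mem_maximalAtlas (h x)) (by simp) (fun y hy => by simpa using hy)
    fun y _ => rfl

end LocalDiffeo

/-! ### The function `q` in the coordinates of the symmetrized bidisc -/

/-- The denominator of `q²`, in terms of `s = z₁ + z₂` and `p = z₁ z₂`. -/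
def qDenom (w : ℂ × ℂ) : ℝ := 1 + ‖w.1 ^ 2 - 4 * w.2‖ / 2 - ‖w.1‖ ^ 2 / 2 + ‖w.2‖ ^ 2

/-- The function `q` as an explicit function of `s = z₁ + z₂` and `p = z₁ z₂`. -/
def qFun (w : ℂ × ℂ) : ℝ := √(‖w.1 ^ 2 - 4 * w.2‖ / qDenom w)

theorem norm_discriminant_sym (z₁ z₂ : ℂ) :
    ‖(sym (z₁, z₂)).1 ^ 2 - 4 * (sym (z₁, z₂)).2‖ = ‖z₁ - z₂‖ ^ 2 := by
  rw [← norm_pow]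
  congr 1
  simp only [sym]
  ring

/-- Polarization: `2 Re (z̄₁ z₂)` is half the difference of `|z₁ + z₂|²` and `|z₁ - z₂|²`. -/
theorem qDenom_sym (z₁ z₂ : ℂ) : qDenom (sym (z₁, z₂)) = ‖1 - conj z₁ * z₂‖ ^ 2 := by
  rw [qDenom, norm_discriminant_sym]
  simp only [sym, ← Complex.normSq_eq_norm_sq, Complex.normSq_apply, Complex.sub_re,
    Complex.sub_im, Complex.add_re, Complex.add_im, Complex.mul_re, Complex.mul_im,
    Complex.conj_re, Complex.conj_im, Complex.one_re, Complex.one_im]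
  ring

theorem qFun_sym (z₁ z₂ : ℂ) : qFun (sym (z₁, z₂)) = ‖moebius z₁ z₂‖ := by
  rw [qFun, norm_discriminant_sym, qDenom_sym, ← div_pow, Real.sqrt_sq (by positivity), moebius,
    norm_div]

/-- The formula holds for whichever preimage was chosen in the definition of `q`; since `qFun` sees
only the point of `𝔾`, the value does not depend on that choice. -/
theorem coe_q (w : symBidisc) : (q w : ℝ) = qFun w := by
  conv_rhs => rw [← w.2.choose_spec.2]
  exact (qFun_sym _ _).symm

theorem coe_qRestrict (w : symBidiscMinusRoyal) : (qRestrict w : ℝ) = qFun w :=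
  coe_q _

theorem mem_leafL_iff {a : ℝ} {w : symBidiscMinusRoyal} : w ∈ leafL a ↔ qFun w = a := by
  rw [leafL, Set.mem_ofPred_eq, coe_qRestrict]

theorem mem_leafF_iff {a : ℝ} {z : bidiscMinusDiagonal} : z ∈ leafF a ↔ qFun (sym z) = a := by
  rw [leafF, Set.mem_ofPred_eq, ← qFun_sym]

/-! ### The symmetrization map off the diagonal -/

theorem mem_bidiscMinusDiagonal_iff {z : ℂ × ℂ} :
    z ∈ bidiscMinusDiagonal ↔ z.1 ∈ disc ∧ z.2 ∈ disc ∧ z.1 ≠ z.2 := by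
  obtain ⟨z₁, z₂⟩ := z
  constructor
  · rintro ⟨⟨h1, h2⟩, h3⟩
    exact ⟨h1, h2, fun h => h3 ⟨z₁, h1, Prod.ext rfl h.symm⟩⟩
  · rintro ⟨h1, h2, h3⟩
    refine ⟨⟨h1, h2⟩, ?_⟩
    rintro ⟨z, -, h⟩
    obtain ⟨rfl, rfl⟩ := Prod.mk.inj h
    exact h3 rfl

theorem sym_mem_symBidiscMinusRoyal {z : ℂ × ℂ} (hz : z ∈ bidiscMinusDiagonal) :
    sym z ∈ symBidiscMinusRoyal := by
  obtain ⟨h1, h2, h3⟩ := mem_bidiscMinusDiagonal_iff.1 hz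
  exact ⟨⟨z, ⟨h1, h2⟩, rfl⟩, fun h => h3 ((sym_mem_royalVariety_iff h1).1 h)⟩

theorem exists_sym_eq {w : ℂ × ℂ} (hw : w ∈ symBidiscMinusRoyal) :
    ∃ z ∈ bidiscMinusDiagonal, sym z = w := by
  obtain ⟨⟨z, ⟨h1, h2⟩, rfl⟩, h⟩ := hw
  exact ⟨z, mem_bidiscMinusDiagonal_iff.2
    ⟨h1, h2, fun h' => h ((sym_mem_royalVariety_iff h1).2 h')⟩, rfl⟩

/-- By Vieta, `z₁` is a root of `(T - w₁)(T - w₂)`, and the sum then fixes `z₂`. -/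
theorem eq_or_eq_swap_of_sym_eq {z w : ℂ × ℂ} (h : sym z = sym w) : z = w ∨ z = w.swap := by
  obtain ⟨z₁, z₂⟩ := z
  obtain ⟨w₁, w₂⟩ := w
  obtain ⟨hs, hp⟩ := Prod.mk.inj h
  have hs : z₁ + z₂ = w₁ + w₂ := hs
  have hp : z₁ * z₂ = w₁ * w₂ := hp
  have h0 : (z₁ - w₁) * (z₁ - w₂) = 0 := by linear_combination z₁ * hs - hp
  rcases mul_eq_zero.1 h0 with h1 | h1
  · left
    have h1 := sub_eq_zero.1 h1
    exact Prod.ext h1 (by linear_combination hs - h1)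
  · right
    have h1 := sub_eq_zero.1 h1
    exact Prod.ext h1 (show z₂ = w₁ by linear_combination hs - h1)

theorem contDiff_sym : ContDiff ℝ ∞ sym := by
  unfold sym
  fun_prop

theorem hasFDerivAt_sym (z : ℂ × ℂ) :
    HasFDerivAt sym ((ContinuousLinearMap.fst ℝ ℂ ℂ + ContinuousLinearMap.snd ℝ ℂ ℂ).prod
      (z.1 • ContinuousLinearMap.snd ℝ ℂ ℂ + z.2 • ContinuousLinearMap.fst ℝ ℂ ℂ)) z := by
  have h1 : HasFDerivAt Prod.fst (ContinuousLinearMap.fst ℝ ℂ ℂ) z := hasFDerivAt_fst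
  have h2 : HasFDerivAt Prod.snd (ContinuousLinearMap.snd ℝ ℂ ℂ) z := hasFDerivAt_snd
  exact (h1.add h2).prodMk (h1.mul h2)

/-- Off the diagonal, `sym` is a local diffeomorphism. -/
theorem exists_isSmoothCoord_sym {z : ℂ × ℂ} (hz : z ∈ bidiscMinusDiagonal) :
    ∃ e : OpenPartialHomeomorph (ℂ × ℂ) (ℂ × ℂ), z ∈ e.source ∧
      e.source ⊆ bidiscMinusDiagonal ∧ (e : ℂ × ℂ → ℂ × ℂ) = sym ∧ IsSmoothCoord e := by
  obtain ⟨-, -, hne⟩ := mem_bidiscMinusDiagonal_iff.1 hz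
  have hd := hasFDerivAt_sym z
  set L : ℂ × ℂ →L[ℝ] ℂ × ℂ :=
    (ContinuousLinearMap.fst ℝ ℂ ℂ + ContinuousLinearMap.snd ℝ ℂ ℂ).prod
      (z.1 • ContinuousLinearMap.snd ℝ ℂ ℂ + z.2 • ContinuousLinearMap.fst ℝ ℂ ℂ) with hL
  have hinj : Function.Injective (L : ℂ × ℂ →ₗ[ℝ] ℂ × ℂ) := by
    rw [injective_iff_map_eq_zero]
    rintro ⟨a, b⟩ hab
    have ha : a + b = 0 := congrArg Prod.fst hab
    have hb : z.1 * b + z.2 * a = 0 := congrArg Prod.snd hab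
    -- The complex Jacobian determinant of `sym` is `z₁ - z₂` up to sign.
    have : (z.1 - z.2) * b = 0 := by linear_combination hb - z.2 * ha
    have hb0 : b = 0 := (mul_eq_zero.1 this).resolve_left (sub_ne_zero.2 hne)
    rw [hb0, add_zero] at ha
    rw [ha, hb0, Prod.mk_zero_zero]
  let A : (ℂ × ℂ) ≃L[ℝ] ℂ × ℂ :=
    (LinearEquiv.ofInjectiveEndo (L : ℂ × ℂ →ₗ[ℝ] ℂ × ℂ) hinj).toContinuousLinearEquiv
  have hA : (A : ℂ × ℂ →L[ℝ] ℂ × ℂ) = L := rfl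
  rw [← hA] at hd
  exact exists_isSmoothCoord bidiscMinusDiagonal.2 contDiff_sym.contDiffOn hz hd

/-! ### Regularity of `q` -/

/-- The norm and the square root are smooth away from zero, and here both `|s² - 4p| = |z₁ - z₂|²`
and the denominator `|1 - z̄₁ z₂|²` are nonzero. -/
theorem contDiffOn_qFun : ContDiffOn ℝ ∞ qFun symBidiscMinusRoyal := by
  intro w hw
  obtain ⟨⟨z₁, z₂⟩, hz, rfl⟩ := exists_sym_eq hw
  obtain ⟨h1, h2, h3⟩ := mem_bidiscMinusDiagonal_iff.1 hz
  have hm : (sym (z₁, z₂)).1 ^ 2 - 4 * (sym (z₁, z₂)).2 ≠ 0 := by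
    rw [← norm_ne_zero_iff, norm_discriminant_sym]
    exact pow_ne_zero _ (norm_ne_zero_iff.2 (sub_ne_zero.2 h3))
  have hD : qDenom (sym (z₁, z₂)) ≠ 0 := by
    rw [qDenom_sym]
    exact pow_ne_zero _ (norm_ne_zero_iff.2 (denom_ne_zero h1 h2))
  have hN : ContDiffAt ℝ ∞ (fun w : ℂ × ℂ => ‖w.1 ^ 2 - 4 * w.2‖) (sym (z₁, z₂)) :=
    ContDiffAt.norm ℝ (by fun_prop) hm
  have hs : ContDiff ℝ ∞ (fun w : ℂ × ℂ => ‖w.1‖ ^ 2) := contDiff_fst.norm_sq ℝ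
  have hp : ContDiff ℝ ∞ (fun w : ℂ × ℂ => ‖w.2‖ ^ 2) := contDiff_snd.norm_sq ℝ
  have hDc : ContDiffAt ℝ ∞ qDenom (sym (z₁, z₂)) :=
    ((contDiffAt_const.add (hN.div_const 2)).sub (hs.contDiffAt.div_const 2)).add hp.contDiffAt
  exact ((hN.div hDc hD).sqrt (div_ne_zero (norm_ne_zero_iff.2 hm) hD)).contDiffWithinAt

/-- This allows `z₂` to be parametrized by `u = φ_{z₁} (z₂)`, in which `q` is just `|u|`. -/
theorem moebius_moebius {α z : ℂ} (hα : α ∈ disc) (hz : z ∈ disc) :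
    moebius α (moebius α z) = z := by
  have h1 := denom_ne_zero hα hz
  have h2 := denom_ne_zero hα hα
  have h3 : 1 - conj α * ((α - z) / (1 - conj α * z)) ≠ 0 := by
    have : 1 - conj α * ((α - z) / (1 - conj α * z))
        = (1 - conj α * α) / (1 - conj α * z) := by
      field_simp
      ring
    rw [this]
    exact div_ne_zero h2 h1
  rw [moebius, moebius, div_eq_iff h3, sub_eq_iff_eq_add]
  linear_combination (-1 : ℂ) * div_mul_cancel₀ (α - z) h1

theorem moebius_mem_disc {α z : ℂ} (hα : α ∈ disc) (hz : z ∈ disc) : moebius α z ∈ disc :=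
  mem_disc.2 (norm_moebius_lt_one hα hz)

theorem norm_moebius_pos {α z : ℂ} (hα : α ∈ disc) (hz : z ∈ disc) (h : α ≠ z) :
    0 < ‖moebius α z‖ :=
  norm_pos_iff.2 (div_ne_zero (sub_ne_zero.2 h) (denom_ne_zero hα hz))

/-- The target is a line, so one tangent vector with nonzero image suffices. It is the velocity of
`t ↦ sym (z₁, φ_{z₁} (t b/|b|))`, which meets the given point at `t = |b|` and along which `q = t`.
-/
theorem surjective_fderiv_qFun {w : ℂ × ℂ} (hw : w ∈ symBidiscMinusRoyal) :
    Function.Surjective (fderiv ℝ qFun w) := by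
  have hq : DifferentiableAt ℝ qFun w := (contDiffOn_qFun.contDiffAt
    (symBidiscMinusRoyal.2.mem_nhds hw)).differentiableAt (by simp)
  obtain ⟨⟨z₁, z₂⟩, hz, rfl⟩ := exists_sym_eq hw
  obtain ⟨h1, h2, h3⟩ := mem_bidiscMinusDiagonal_iff.1 hz
  set b := moebius z₁ z₂ with hb
  have hbd : b ∈ disc := moebius_mem_disc h1 h2
  have hb1 : ‖b‖ < 1 := mem_disc.1 hbd
  have hb0 : 0 < ‖b‖ := norm_moebius_pos h1 h2 h3
  -- the curve along which `q` grows with unit speed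
  let γ : ℝ → ℂ × ℂ := fun t => sym (z₁, moebius z₁ (t * (b / ‖b‖)))
  have hb' : ((‖b‖ : ℝ) : ℂ) * (b / ‖b‖) = b :=
    mul_div_cancel₀ b (Complex.ofReal_ne_zero.2 hb0.ne')
  have hγb : γ ‖b‖ = sym (z₁, z₂) := by
    simp only [γ, hb']
    rw [hb, moebius_moebius h1 h2]
  have hmem : ∀ t ∈ Set.Ioo (0 : ℝ) 1, ‖(t : ℂ) * (b / ‖b‖)‖ = t := fun t ht => by
    rw [norm_mul, norm_div, Complex.norm_real, Complex.norm_real, norm_norm,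
      div_self hb0.ne', mul_one, Real.norm_of_nonneg ht.1.le]
  have hqγ : ∀ t ∈ Set.Ioo (0 : ℝ) 1, qFun (γ t) = t := fun t ht => by
    have h := hmem t ht
    rw [qFun_sym, moebius_moebius h1 (mem_disc.2 (h.trans_lt ht.2)), h]
  have hγ : DifferentiableAt ℝ γ ‖b‖ := by
    have hlin : DifferentiableAt ℝ (fun t : ℝ => (t : ℂ) * (b / ‖b‖)) ‖b‖ :=
      (Complex.ofRealCLM.differentiableAt).mul_const _
    have hden : 1 - conj z₁ * (((‖b‖ : ℝ) : ℂ) * (b / ‖b‖)) ≠ 0 := by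
      rw [hb']
      exact denom_ne_zero h1 hbd
    have hmo : DifferentiableAt ℝ (fun t : ℝ => moebius z₁ ((t : ℂ) * (b / ‖b‖))) ‖b‖ :=
      (hlin.const_sub z₁).div ((hlin.const_mul _).const_sub 1) hden
    exact ((contDiff_sym.differentiable (by simp)).differentiableAt).comp ‖b‖
      ((differentiableAt_const z₁).prodMk hmo)
  have hcomp : HasDerivAt (fun t => qFun (γ t)) (fderiv ℝ qFun (sym (z₁, z₂)) (deriv γ ‖b‖))
      ‖b‖ := by
    have hq' : HasFDerivAt qFun (fderiv ℝ qFun (sym (z₁, z₂))) (γ ‖b‖) := by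
      rw [hγb]
      exact hq.hasFDerivAt
    exact hq'.comp_hasDerivAt ‖b‖ hγ.hasDerivAt
  have hone : fderiv ℝ qFun (sym (z₁, z₂)) (deriv γ ‖b‖) = 1 := by
    refine hcomp.unique ((hasDerivAt_id ‖b‖).congr_of_eventuallyEq ?_)
    filter_upwards [Ioo_mem_nhds hb0 hb1] with t ht using hqγ t ht
  intro c
  exact ⟨c • deriv γ ‖b‖, by rw [map_smul, hone, smul_eq_mul, mul_one]⟩

/-! ### Coordinates adapted to `q` -/

/-- The real line as a one-dimensional Euclidean space. -/
def realEquiv : ℝ ≃L[ℝ] EuclideanSpace ℝ (Fin 1) :=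
  ContinuousLinearEquiv.ofFinrankEq (by simp)

/-- The identification of `ℂ² = ℝ⁴` with `ℝ³ × ℝ`. -/
def prodEquiv : (EuclideanSpace ℝ (Fin 3) × EuclideanSpace ℝ (Fin 1)) ≃L[ℝ] ℂ × ℂ :=
  ContinuousLinearEquiv.ofFinrankEq (by simp [Complex.finrank_real_complex])

/-- Around each point of `𝔾 ∖ Δ` there are smooth coordinates with last coordinate `q`. -/
theorem exists_isSmoothCoord_qFun {w : ℂ × ℂ} (hw : w ∈ symBidiscMinusRoyal) :
    ∃ e : OpenPartialHomeomorph (ℂ × ℂ) (EuclideanSpace ℝ (Fin 3) × EuclideanSpace ℝ (Fin 1)),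
      w ∈ e.source ∧ e.source ⊆ symBidiscMinusRoyal ∧ (∀ y, (e y).2 = realEquiv (qFun y)) ∧
      IsSmoothCoord e := by
  refine exists_isSmoothCoord_snd symBidiscMinusRoyal.2
    (realEquiv.contDiff.comp_contDiffOn contDiffOn_qFun) hw ?_
    (by simp [Complex.finrank_real_complex])
  have hq : DifferentiableAt ℝ qFun w := (contDiffOn_qFun.contDiffAt
    (symBidiscMinusRoyal.2.mem_nhds hw)).differentiableAt (by simp)
  rw [(realEquiv.hasFDerivAt.comp w hq.hasFDerivAt).fderiv]
  exact realEquiv.surjective.comp (surjective_fderiv_qFun hw)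

theorem isSubmersion_qRestrict : Manifold.IsSubmersion 𝓘(ℝ, ℂ × ℂ) 𝓘(ℝ, ℝ) ∞ qRestrict := by
  refine ⟨EuclideanSpace ℝ (Fin 3), inferInstance, inferInstance, fun w => ?_⟩
  have hU : Nonempty symBidiscMinusRoyal := ⟨w⟩
  obtain ⟨e, hwe, -, he, hs⟩ := exists_isSmoothCoord_qFun w.2
  let e' := e.trans prodEquiv.toHomeomorph.toOpenPartialHomeomorph
  have he's : e'.source = e.source := by
    ext y
    simp [e']
  refine Manifold.IsSubmersionAtOfComplement.mk_of_charts
    -- The coordinate `q` is moved to the first factor and read as a real number, so that `q`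
    -- becomes the first projection.
    ((prodEquiv.symm.trans (ContinuousLinearEquiv.prodComm ℝ _ _)).trans
      (realEquiv.symm.prodCongr (ContinuousLinearEquiv.refl ℝ _)))
    (e'.subtypeRestr hU) (chartAt ℝ (qRestrict w)) ?_ (mem_chart_source _ _)
    ((hs.trans (ContinuousLinearEquiv.isSmoothCoord prodEquiv)).subtypeRestr_mem_maximalAtlas _ hU)
    (IsManifold.chart_mem_maximalAtlas _) (fun _ _ => ⟨trivial, trivial⟩) ?_
  · rw [OpenPartialHomeomorph.subtypeRestr_source, Set.mem_preimage, he's]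
    exact hwe
  · intro u hu
    rw [OpenPartialHomeomorph.extend_target] at hu
    replace hu : u ∈ (e'.subtypeRestr hU).target := hu.1
    change (qRestrict ((e'.subtypeRestr hU).symm u) : ℝ) = realEquiv.symm (prodEquiv.symm u).2
    rw [coe_qRestrict, ← Function.comp_apply (f := Subtype.val),
      e'.subtypeRestr_symm_apply hU hu]
    change qFun (e.symm (prodEquiv.symm u)) = _
    rw [← realEquiv.symm_apply_apply (qFun _), ← he, e.right_inv]
    have h2 := e'.subtypeRestr_target_subset hU hu
    exact h2.2

theorem surjective_qRestrict : Function.Surjective qRestrict := by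
  rintro ⟨a, ha0, ha1⟩
  have h0 : (0 : ℂ) ∈ disc := by simp [disc]
  have ha : (a : ℂ) ∈ disc := by
    rw [mem_disc, Complex.norm_real, Real.norm_of_nonneg ha0.le]
    exact ha1
  -- Since `φ_0 (a) = -a`, the pair `(0, a)` has `q = a`.
  have hz : ((0 : ℂ), (a : ℂ)) ∈ bidiscMinusDiagonal :=
    mem_bidiscMinusDiagonal_iff.2 ⟨h0, ha, fun h => ha0.ne (Complex.ofReal_injective h)⟩
  refine ⟨⟨_, sym_mem_symBidiscMinusRoyal hz⟩, Subtype.ext ?_⟩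
  rw [coe_qRestrict, qFun_sym]
  simp [moebius, abs_of_pos ha0]

/-! ### The level sets -/

theorem isConnected_leafL {a : ℝ} (ha : a ∈ Set.Ioo (0 : ℝ) 1) : IsConnected (leafL a) := by
  constructor
  · obtain ⟨w, hw⟩ := surjective_qRestrict ⟨a, ha⟩
    exact ⟨w, congrArg Subtype.val hw⟩
  let P : ℂ × ℝ → ℂ × ℂ := fun x => sym (x.1, moebius x.1 (a * Complex.exp (x.2 * Complex.I)))
  have hnorm : ∀ θ : ℝ, ‖(a : ℂ) * Complex.exp (θ * Complex.I)‖ = a := fun θ => by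
    rw [norm_mul, Complex.norm_exp_ofReal_mul_I, Complex.norm_real, mul_one,
      Real.norm_of_nonneg ha.1.le]
  have hdisc : ∀ θ : ℝ, (a : ℂ) * Complex.exp (θ * Complex.I) ∈ disc := fun θ =>
    mem_disc.2 ((hnorm θ).trans_lt ha.2)
  have himage : Subtype.val '' leafL a = P '' (disc ×ˢ Set.univ) := by
    ext w
    constructor
    · rintro ⟨⟨_, hw⟩, hwa, rfl⟩
      obtain ⟨⟨z₁, z₂⟩, hz, rfl⟩ := exists_sym_eq hw
      obtain ⟨h1, h2, -⟩ := mem_bidiscMinusDiagonal_iff.1 hz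
      rw [mem_leafL_iff, qFun_sym] at hwa
      -- As `|φ_{z₁} (z₂)| = a`, its polar form is `a e^{iθ}`, and the involution recovers `z₂`.
      refine ⟨(z₁, Complex.arg (moebius z₁ z₂)), ⟨h1, trivial⟩, ?_⟩
      simp only [P, ← hwa, Complex.norm_mul_exp_arg_mul_I, moebius_moebius h1 h2]
    · rintro ⟨⟨z, θ⟩, ⟨hz, -⟩, rfl⟩
      have hq : qFun (P (z, θ)) = a := by
        simp only [P]
        rw [qFun_sym, moebius_moebius hz (hdisc θ), hnorm]
      have hmem : P (z, θ) ∈ symBidiscMinusRoyal := by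
        refine sym_mem_symBidiscMinusRoyal (mem_bidiscMinusDiagonal_iff.2
          ⟨hz, moebius_mem_disc hz (hdisc θ), fun h => ?_⟩)
        have h' : z = moebius z (a * Complex.exp (θ * Complex.I)) := h
        simp only [P] at hq
        rw [← h', qFun_sym, moebius, sub_self, zero_div, norm_zero] at hq
        exact ha.1.ne hq
      exact ⟨⟨_, hmem⟩, mem_leafL_iff.2 hq, rfl⟩
  refine Topology.IsInducing.subtypeVal.isPreconnected_image.1 (himage ▸ ?_)
  refine (((convex_ball (0 : ℂ) 1).isPreconnected).prod isPreconnected_univ).image P ?_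
  have hb : ContinuousOn (fun x : ℂ × ℝ => (a : ℂ) * Complex.exp (x.2 * Complex.I))
      (disc ×ˢ Set.univ) := by
    fun_prop
  have hc : ContinuousOn (fun x : ℂ × ℝ => conj x.1) (disc ×ˢ Set.univ) :=
    (Complex.continuous_conj.comp continuous_fst).continuousOn
  exact contDiff_sym.continuous.comp_continuousOn (continuousOn_fst.prodMk
    ((continuousOn_fst.sub hb).div (continuousOn_const.sub (hc.mul hb))
      fun x hx => denom_ne_zero hx.1 (hdisc _)))

/-- Coordinates in which `𝓛_a` is a slice. -/
theorem nonempty_sliceChart_leafL {a : ℝ} (w : leafL a) :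
    Nonempty (SliceChart (EuclideanSpace ℝ (Fin 3)) (EuclideanSpace ℝ (Fin 1)) (leafL a) w) := by
  obtain ⟨e, hwe, heU, he, hs⟩ := exists_isSmoothCoord_qFun w.1.2
  exact ⟨⟨e, realEquiv a, hs, hwe, heU, fun y _ => by
    rw [mem_leafL_iff, he, realEquiv.injective.eq_iff]⟩⟩

/-- A choice of slice charts of `𝓛_a`. -/
def sliceL {a : ℝ} (w : leafL a) :
    SliceChart (EuclideanSpace ℝ (Fin 3)) (EuclideanSpace ℝ (Fin 1)) (leafL a) w :=
  (nonempty_sliceChart_leafL w).some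

/-- The map `𝓕_a → 𝓛_a` induced by `sym`. -/
def symF {a : ℝ} (z : leafF a) : leafL a :=
  ⟨⟨sym z, sym_mem_symBidiscMinusRoyal z.1.2⟩, mem_leafL_iff.2 (mem_leafF_iff.1 z.2)⟩

/-- The local coordinates at a point of `𝓕_a` given by the slice chart of `𝓛_a` at its image. -/
def sliceF {a : ℝ} (z : leafF a) :
    SliceChart (EuclideanSpace ℝ (Fin 3)) (EuclideanSpace ℝ (Fin 1)) (leafF a) z :=
  have h := exists_isSmoothCoord_sym z.1.2
  -- Composing with `sym` makes `symF` the identity in the resulting charts, hence a local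
  -- diffeomorphism.
  { coord := h.choose.trans (sliceL (symF z)).coord
    c := (sliceL (symF z)).c
    isSmoothCoord := h.choose_spec.2.2.2.trans (sliceL (symF z)).isSmoothCoord
    mem_source := ⟨h.choose_spec.1, by
      change h.choose z.1.1 ∈ (sliceL (symF z)).coord.source
      rw [h.choose_spec.2.2.1]
      exact (sliceL (symF z)).mem_source⟩
    source_subset := fun _ hy => h.choose_spec.2.1 hy.1
    mem_iff := fun y hy => by
      have hy2 : sym y ∈ (sliceL (symF z)).coord.source := by
        rw [← h.choose_spec.2.2.1]
        exact hy.2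
      rw [OpenPartialHomeomorph.coe_trans, Function.comp_apply, h.choose_spec.2.2.1,
        ← (sliceL (symF z)).mem_iff ⟨sym y, sym_mem_symBidiscMinusRoyal y.2⟩ hy2, mem_leafL_iff,
        mem_leafF_iff] }

theorem symF_mem_source {a : ℝ} {z y : leafF a} (hy : y ∈ (sliceF z).toChart.source) :
    symF y ∈ (sliceL (symF z)).toChart.source := by
  have h := exists_isSmoothCoord_sym z.1.2
  have hy2 : h.choose (y.1.1) ∈ (sliceL (symF z)).coord.source := hy.2
  rw [h.choose_spec.2.2.1] at hy2
  exact hy2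

theorem toChart_symF {a : ℝ} {z y : leafF a} :
    (sliceF z).toChart y = (sliceL (symF z)).toChart (symF y) := by
  have h := exists_isSmoothCoord_sym z.1.2
  change ((sliceL (symF z)).coord (h.choose y.1.1)).1 = ((sliceL (symF z)).coord (sym y.1.1)).1
  rw [h.choose_spec.2.2.1]

theorem isLocalDiffeomorph_symF (a : ℝ) :
    letI : ChartedSpace (EuclideanSpace ℝ (Fin 3)) (leafL a) := SliceChart.chartedSpace sliceL
    letI : ChartedSpace (EuclideanSpace ℝ (Fin 3)) (leafF a) := SliceChart.chartedSpace sliceF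
    IsLocalDiffeomorph (𝓡 3) (𝓡 3) ∞ (symF : leafF a → leafL a) := by
  let _ : ChartedSpace (EuclideanSpace ℝ (Fin 3)) (leafL a) := SliceChart.chartedSpace sliceL
  let _ : ChartedSpace (EuclideanSpace ℝ (Fin 3)) (leafF a) := SliceChart.chartedSpace sliceF
  have := SliceChart.isManifold (sliceL (a := a))
  have := SliceChart.isManifold (sliceF (a := a))
  intro z
  exact isLocalDiffeomorphAt_of_charts (IsManifold.chart_mem_maximalAtlas z)
    (IsManifold.chart_mem_maximalAtlas (symF z)) (mem_chart_source _ z)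
    (fun y hy => symF_mem_source hy) fun y _ => toChart_symF

/-! ### The quotient by `ℤ₂` -/

theorem symF_surjective (a : ℝ) : Function.Surjective (symF : leafF a → leafL a) := by
  intro w
  obtain ⟨z, hz, h⟩ := exists_sym_eq w.1.2
  have hza : (⟨z, hz⟩ : bidiscMinusDiagonal) ∈ leafF a :=
    mem_leafF_iff.2 ((congrArg qFun h).trans (mem_leafL_iff.1 w.2))
  exact ⟨⟨⟨z, hz⟩, hza⟩, Subtype.ext (Subtype.ext h)⟩

theorem symF_swapF {a : ℝ} (z : leafF a) : symF (swapF z) = symF z :=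
  Subtype.ext (Subtype.ext (Prod.ext (add_comm _ _) (mul_comm _ _)))

theorem neg_one_smul_leafF {a : ℝ} (z : leafF a) : (-1 : ℤˣ) • z = swapF z :=
  if_neg (by decide)

theorem orbitRel_iff_symF_eq {a : ℝ} {z z' : leafF a} :
    MulAction.orbitRel ℤˣ (leafF a) z z' ↔ symF z = symF z' := by
  rw [MulAction.orbitRel_apply, MulAction.mem_orbit_iff]
  constructor
  · rintro ⟨u, rfl⟩
    rcases Int.units_eq_one_or u with rfl | rfl
    · rw [one_smul]
    · rw [neg_one_smul_leafF, symF_swapF]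
  · intro h
    rcases eq_or_eq_swap_of_sym_eq (congrArg (fun w : leafL a => (w : ℂ × ℂ)) h) with h | h
    · exact ⟨1, by rw [one_smul]; exact Subtype.ext (Subtype.ext h.symm)⟩
    · exact ⟨-1, by rw [neg_one_smul_leafF]; exact Subtype.ext (Subtype.ext h.symm)⟩

/-- Openness is purely topological; the smooth structures enter only through
`isLocalDiffeomorph_symF`. -/
theorem isOpenMap_symF (a : ℝ) : IsOpenMap (symF : leafF a → leafL a) := by
  let _ : ChartedSpace (EuclideanSpace ℝ (Fin 3)) (leafL a) := SliceChart.chartedSpace sliceL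
  let _ : ChartedSpace (EuclideanSpace ℝ (Fin 3)) (leafF a) := SliceChart.chartedSpace sliceF
  exact (isLocalDiffeomorph_symF a).isOpenMap

theorem continuous_symF (a : ℝ) : Continuous (symF : leafF a → leafL a) :=
  ((contDiff_sym.continuous.comp
    (continuous_subtype_val.comp continuous_subtype_val)).subtype_mk _).subtype_mk _

/-- The homeomorphism `𝓕_a / ℤ₂ ≃ 𝓛_a` induced by `sym`. -/
def quotientHomeomorph (a : ℝ) : quotientF a ≃ₜ leafL a :=
  (Equiv.ofBijective (Quotient.lift symF fun _ _ h => orbitRel_iff_symF_eq.1 h)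
    ⟨by
      rintro ⟨z⟩ ⟨z'⟩ h
      exact Quotient.sound (orbitRel_iff_symF_eq.2 h),
    fun w => by
      obtain ⟨z, rfl⟩ := symF_surjective a w
      exact ⟨quotientMap a z, rfl⟩⟩).toHomeomorphOfContinuousOpen
    ((continuous_symF a).quotient_lift _) (by
      intro V hV
      have hV' : IsOpen (quotientMap a ⁻¹' V) := hV.preimage continuous_quotient_mk'
      -- The image of `V` in `𝓛_a` equals the image under `symF` of its preimage in `𝓕_a`.
      convert isOpenMap_symF a _ hV'
      ext w
      constructor
      · rintro ⟨⟨z⟩, hz, rfl⟩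
        exact ⟨z, hz, rfl⟩
      · rintro ⟨z, hz, rfl⟩
        exact ⟨quotientMap a z, hz, rfl⟩)

/-! ### The foliation -/

/-- The foliation of `𝔾 ∖ Δ` whose distinguished charts have `q` as last coordinate. -/
def qFoliation : Foliation 𝓘(ℝ, ℂ × ℂ) symBidiscMinusRoyal 3 1 where
  charts := {e |
    ContMDiffOn 𝓘(ℝ, ℂ × ℂ) 𝓘(ℝ, EuclideanSpace ℝ (Fin 3) × EuclideanSpace ℝ (Fin 1)) ∞ e
      e.source ∧
    ContMDiffOn 𝓘(ℝ, EuclideanSpace ℝ (Fin 3) × EuclideanSpace ℝ (Fin 1)) 𝓘(ℝ, ℂ × ℂ) ∞ e.symm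
      e.target ∧
    (∃ (x₀ : EuclideanSpace ℝ (Fin 3)) (y₀ : EuclideanSpace ℝ (Fin 1)) (r s : ℝ),
      0 < r ∧ 0 < s ∧ e.target = Metric.ball x₀ r ×ˢ Metric.ball y₀ s) ∧
    ∀ w, (e w).2 = realEquiv (qFun w)}
  smooth_chart e he := he.1
  smooth_symm e he := he.2.1
  target_eq e he := he.2.2.1
  cover w := by
    obtain ⟨e₀, hwe, -, he₀, hs⟩ := exists_isSmoothCoord_qFun w.2
    have hU : Nonempty symBidiscMinusRoyal := ⟨w⟩
    let e := e₀.subtypeRestr hU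
    have hw : w ∈ e.source := by
      rw [e₀.subtypeRestr_source]
      exact hwe
    obtain ⟨r, hr, hball⟩ := Metric.isOpen_iff.1 e.open_target _ (e.map_source hw)
    let B := Metric.ball (e w).1 r ×ˢ Metric.ball (e w).2 r
    have hB : IsOpen B := Metric.isOpen_ball.prod Metric.isOpen_ball
    have hBe : B ⊆ e.target := fun y hy =>
      hball ((ball_prod_same (e w).1 (e w).2 r).subset hy)
    -- Restricting the inverse cuts the target, rather than the source, down to the product of balls
    -- `B`.
    let e' := (e.symm.restrOpen B hB).symm
    have hsource : e'.source ⊆ e.source := by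
      rintro y hy
      have h := e'.map_source hy
      have h2 := e'.left_inv hy
      rw [← h2]
      exact e.map_target (hBe h.2)
    refine ⟨e', ⟨?_, ?_, ⟨(e w).1, (e w).2, r, r, hr, hr, ?_⟩, fun y => he₀ y⟩, ?_⟩
    · exact (hs.contMDiffOn_subtypeRestr _ hU).mono hsource
    · exact (hs.contMDiffOn_subtypeRestr_symm _ hU).mono fun y hy => hy.1
    · exact Set.inter_eq_right.2 hBe
    · have hwB : e w ∈ e'.target :=
        ⟨e.map_source hw, Metric.mem_ball_self hr, Metric.mem_ball_self hr⟩
      have := e'.map_target hwB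
      rwa [show e'.symm (e w) = w from e.left_inv hw] at this
  compatible e he e' he' u hu v hv huv := by
    have h1 := he.2.2.2 (e.symm u)
    have h2 := he.2.2.2 (e.symm v)
    rw [e.right_inv hu.1] at h1
    rw [e.right_inv hv.1] at h2
    rw [he'.2.2.2, he'.2.2.2, ← h1, ← h2, huv]

theorem samePlaque_qFoliation {w w' : symBidiscMinusRoyal} (h : qFoliation.SamePlaque w w') :
    qFun w = qFun w' := by
  obtain ⟨e, he, -, -, h⟩ := h
  rwa [he.2.2.2, he.2.2.2, realEquiv.injective.eq_iff] at h

/-- Plaques stay in a level set because `q` is the transverse coordinate. Conversely, nearby points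
of a level set share a plaque, so reachability is an equivalence relation with relatively open
classes on a connected set. -/
theorem leaf_qFoliation (w : symBidiscMinusRoyal) : qFoliation.leaf w = leafL (qFun w) := by
  have hq : ∀ w : symBidiscMinusRoyal, qFun w ∈ Set.Ioo (0 : ℝ) 1 := fun w => by
    rw [← coe_qRestrict]
    exact (qRestrict w).2
  ext w'
  constructor
  · intro h
    rw [mem_leafL_iff]
    induction h with
    | refl => rfl
    | tail _ h ih => rw [← samePlaque_qFoliation h, ih]
  · intro hw'
    refine (isConnected_leafL (hq w)).isPreconnected.induction₂
      (fun x y => Relation.ReflTransGen qFoliation.SamePlaque x y) ?_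
      (fun _ _ _ _ _ _ h h' => h.trans h') (fun x y _ _ h => ?_) (mem_leafL_iff.2 rfl) hw'
    · intro x hx
      obtain ⟨e, he, hxe⟩ := qFoliation.cover x
      filter_upwards [mem_nhdsWithin_of_mem_nhds (e.open_source.mem_nhds hxe),
        self_mem_nhdsWithin] with y hye hy
      refine Relation.ReflTransGen.single ⟨e, he, hxe, hye, ?_⟩
      rw [he.2.2.2, he.2.2.2, mem_leafL_iff.1 hx, mem_leafL_iff.1 hy]
    · have : Std.Symm qFoliation.SamePlaque :=
        ⟨fun _ _ ⟨e, he, h1, h2, h3⟩ => ⟨e, he, h2, h1, h3.symm⟩⟩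
      exact symm_of (Relation.ReflTransGen qFoliation.SamePlaque) h

theorem leaves_qFoliation :
    qFoliation.leaves = {S | ∃ a ∈ Set.Ioo (0 : ℝ) 1, S = leafL a} := by
  ext S
  constructor
  · rintro ⟨w, rfl⟩
    exact ⟨qFun w, coe_qRestrict w ▸ (qRestrict w).2, leaf_qFoliation w⟩
  · rintro ⟨a, ha, rfl⟩
    obtain ⟨w, hw⟩ := surjective_qRestrict ⟨a, ha⟩
    refine ⟨w, ?_⟩
    rw [leaf_qFoliation, ← coe_qRestrict, hw]

end SymBidisc

end

theorem theorem2p5 :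
    -- the map `q` on `𝔾` is given by the stated formula
    (∀ (z₁ z₂ : ℂ) (h₁ : z₁ ∈ SymBidisc.disc) (h₂ : z₂ ∈ SymBidisc.disc),
      (SymBidisc.q ⟨(z₁ + z₂, z₁ * z₂), ⟨(z₁, z₂), ⟨h₁, h₂⟩, rfl⟩⟩ : ℝ)
        = ‖SymBidisc.moebius z₁ z₂‖) ∧
    -- its restriction is a submersion of `𝔾 ∖ Δ` onto `(0, 1)`
    Manifold.IsSubmersion 𝓘(ℝ, ℂ × ℂ) 𝓘(ℝ, ℝ) ∞ SymBidisc.qRestrict ∧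
    Function.Surjective SymBidisc.qRestrict ∧
    -- the level sets are the leaves of a foliation of dimension three and codimension one
    (∃ F : SymBidisc.Foliation 𝓘(ℝ, ℂ × ℂ) SymBidisc.symBidiscMinusRoyal 3 1,
      F.leaves = {S | ∃ a ∈ Set.Ioo (0 : ℝ) 1, S = SymBidisc.leafL a}) ∧
    ∀ a ∈ Set.Ioo (0 : ℝ) 1,
      IsConnected (SymBidisc.leafL a) ∧
      -- `𝓛_a` and `𝓕_a` are embedded real submanifolds of dimension three
      ∃ (csL : ChartedSpace (EuclideanSpace ℝ (Fin 3)) (SymBidisc.leafL a))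
        (csF : ChartedSpace (EuclideanSpace ℝ (Fin 3)) (SymBidisc.leafF a)),
        SymBidisc.IsSubmanifoldStructure 𝓘(ℝ, ℂ × ℂ) 3 (SymBidisc.leafL a) csL ∧
        SymBidisc.IsSubmanifoldStructure 𝓘(ℝ, ℂ × ℂ) 3 (SymBidisc.leafF a) csF ∧
        -- the quotient `𝓕_a / ℤ₂` is a smooth manifold, with the quotient map a local
        -- diffeomorphism, and `sym` induces a diffeomorphism of it onto `𝓛_a`
        ∃ (csQ : ChartedSpace (EuclideanSpace ℝ (Fin 3)) (SymBidisc.quotientF a)),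
          IsManifold (𝓡 3) ∞ (SymBidisc.quotientF a) ∧
          IsLocalDiffeomorph (𝓡 3) (𝓡 3) ∞ (SymBidisc.quotientMap a) ∧
          ∃ Φ : Diffeomorph (𝓡 3) (𝓡 3) (SymBidisc.quotientF a) (SymBidisc.leafL a) ∞,
            ∀ z : SymBidisc.leafF a,
              ((Φ (SymBidisc.quotientMap a z) : SymBidisc.symBidiscMinusRoyal) : ℂ × ℂ)
                = SymBidisc.sym z := by
  refine ⟨fun z₁ z₂ h₁ h₂ => ?_, SymBidisc.isSubmersion_qRestrict, SymBidisc.surjective_qRestrict,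
    ⟨SymBidisc.qFoliation, SymBidisc.leaves_qFoliation⟩, fun a ha =>
    ⟨SymBidisc.isConnected_leafL ha, ?_⟩⟩
  · rw [SymBidisc.coe_q]
    exact SymBidisc.qFun_sym z₁ z₂
  let csL : ChartedSpace (EuclideanSpace ℝ (Fin 3)) (SymBidisc.leafL a) :=
    SymBidisc.SliceChart.chartedSpace SymBidisc.sliceL
  let csF : ChartedSpace (EuclideanSpace ℝ (Fin 3)) (SymBidisc.leafF a) :=
    SymBidisc.SliceChart.chartedSpace SymBidisc.sliceF
  have hL := SymBidisc.SliceChart.isManifold (SymBidisc.sliceL (a := a))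
  have hF := SymBidisc.SliceChart.isManifold (SymBidisc.sliceF (a := a))
  -- With the structure pulled back from `𝓛_a`, the induced homeomorphism is automatically a
  -- diffeomorphism.
  let csQ : ChartedSpace (EuclideanSpace ℝ (Fin 3)) (SymBidisc.quotientF a) :=
    SymBidisc.pullbackChartedSpace (SymBidisc.quotientHomeomorph a)
  have hQ : IsManifold (𝓡 3) ∞ (SymBidisc.quotientF a) :=
    SymBidisc.isManifold_pullbackChartedSpace _
  refine ⟨csL, csF,
    SymBidisc.isSubmanifoldStructure_chartedSpace SymBidisc.prodEquiv SymBidisc.sliceL,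
    SymBidisc.isSubmanifoldStructure_chartedSpace SymBidisc.prodEquiv SymBidisc.sliceF,
    csQ, hQ, fun z => ?_,
    (SymBidisc.isLocalDiffeomorph_pullback _).diffeomorphOfBijective
      (SymBidisc.quotientHomeomorph a).bijective, fun z => rfl⟩
  -- In these charts the quotient map has the same local expression as `symF`, namely the identity.
  exact SymBidisc.isLocalDiffeomorphAt_of_charts (IsManifold.chart_mem_maximalAtlas z)
    (SymBidisc.trans_mem_maximalAtlas_pullback (SymBidisc.quotientHomeomorph a)
      (chart_mem_atlas _ (SymBidisc.symF z))) (mem_chart_source _ z)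
    (fun y hy => ⟨trivial, SymBidisc.symF_mem_source hy⟩) fun y _ => SymBidisc.toChart_symF
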